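/- Let $G$ be a finite group, let $\chi_0,\dots,\chi_\ell$ be its irreducible complex characters, with $\chi_0$ the character of the trivial representation, and let $e=c_0,c_1,\dots,c_\ell$ be a set of representatives of the conjugacy classes of $G$. Let $\gamma$ be an $n$-dimensional complex representation of $G$ (faithful or not) with character $\chi_\gamma$. Define the integer matrix $M=(m_{ij})_{0\le i,j\le \ell}$ by $\chi_\gamma\chi_i=\sum_{j=0}^{\ell} m_{ij}\chi_j$, let $C$ be the matrix obtained from $nI-M$ by removing the row and the column corresponding to $\chi_0$, and let $K(\gamma)=\operatorname{coker}(C^t\colon\mathbb{Z}^\ell\to\mathbb{Z}^\ell)$ be the critical group of $\gamma$. Then $$\frac{1}{|G|}\prod_{i=1}^{\ell}\bigl(n-\chi_\gamma(c_i)\bigr)$$ is a nonnegative integer. If $\gamma$ is faithful, then $K(\gamma)$ is finite and this number equals $|K(\gamma)|$; if $\gamma$ is not faithful, this number equals $0$. -/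

import Mathlib

/-- A complex-valued function on `G` is an irreducible character if it is the character (trace
function) of an irreducible finite-dimensional complex representation of `G`. Every such
representation is isomorphic to one on a space `Fin m → ℂ`, see `isIrrChar_character`. -/
def IsIrrChar {G : Type*} [Group G] (χ : G → ℂ) : Prop :=
  ∃ (m : ℕ) (ρ : Representation ℂ G (Fin m → ℂ)), ρ.IsIrreducible ∧ ρ.character = χ

/-- The set of irreducible complex characters of `G`, as a type. -/
abbrev IrrChar (G : Type*) [Group G] : Type _ := {χ : G → ℂ // IsIrrChar χ}

theorem Representation.Equiv.isIrreducible_congr {G V W : Type*} [Group G]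
    [AddCommGroup V] [Module ℂ V] [AddCommGroup W] [Module ℂ W]
    {ρ : Representation ℂ G V} {σ : Representation ℂ G W} (e : ρ.Equiv σ)
    (h : ρ.IsIrreducible) : σ.IsIrreducible := by
  rw [Representation.irreducible_iff_isSimpleModule_asModule] at h ⊢
  refine IsSimpleModule.congr (LinearEquiv.ofBijective
    (Representation.IntertwiningMap.equivLinearMapAsModule σ ρ e.symm.toIntertwiningMap) ?_)
  exact e.symm.toLinearEquiv.bijective

/-- The character of every irreducible finite-dimensional representation is an irreducible
character. -/
theorem isIrrChar_character {G V : Type*} [Group G] [AddCommGroup V] [Module ℂ V]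
    [FiniteDimensional ℂ V] (ρ : Representation ℂ G V) (h : ρ.IsIrreducible) :
    IsIrrChar ρ.character := by
  let e : V ≃ₗ[ℂ] (Fin (Module.finrank ℂ V) → ℂ) := (Module.finBasis ℂ V).equivFun
  let σ : Representation ℂ G (Fin (Module.finrank ℂ V) → ℂ) :=
    { toFun := fun g => e.conj (ρ g)
      map_one' := by ext; simp
      map_mul' := fun a b => by ext; simp }
  let f : ρ.Equiv σ := Representation.Equiv.mk e (fun g => by ext; simp [σ])
  exact ⟨_, σ, f.isIrreducible_congr h, (Representation.char_iso f).symm⟩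

theorem IrrChar.linearIndependent (G : Type*) [Group G] [Finite G] :
    LinearIndependent ℂ (fun χ : IrrChar G => χ.1) := by
  classical
  have := Fintype.ofFinite G
  have hG : (Nat.card G : ℂ) ≠ 0 := Nat.cast_ne_zero.2 Nat.card_pos.ne'
  have := invertibleOfNonzero hG
  have horth : ∀ χ ψ : IrrChar G, (Nat.card G : ℂ)⁻¹ * ∑ g : G, χ.1 g * ψ.1 g⁻¹ =
      if χ = ψ then 1 else 0 := by
    rintro ⟨_, m, ρ, hρ, rfl⟩ ⟨_, k, σ, hσ, rfl⟩
    rw [Representation.char_orthonormal ρ σ]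
    by_cases hn : Nonempty (σ.Equiv ρ)
    · rw [if_pos hn, if_pos (Subtype.ext (Representation.char_iso hn.some).symm)]
    · rw [if_neg hn, if_neg]
      intro heq
      have heq' : ρ.character = σ.character := congrArg Subtype.val heq
      have h1 := Representation.char_orthonormal ρ ρ
      have h2 := Representation.char_orthonormal ρ σ
      rw [if_pos ⟨Representation.Equiv.refl ρ⟩] at h1
      rw [if_neg hn, ← heq', h1] at h2
      exact one_ne_zero h2
  rw [linearIndependent_iff']
  intro s c hc ψ hψ
  have h : ∑ χ ∈ s, c χ * ((Nat.card G : ℂ)⁻¹ * ∑ g : G, χ.1 g * ψ.1 g⁻¹) = 0 := by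
    have h0 : ∀ g : G, ∑ χ ∈ s, c χ * χ.1 g = 0 := fun g => by
      simpa using congrFun hc g
    calc _ = (Nat.card G : ℂ)⁻¹ * ∑ g : G, (∑ χ ∈ s, c χ * χ.1 g) * ψ.1 g⁻¹ := by
          simp_rw [Finset.sum_mul, Finset.mul_sum]
          rw [Finset.sum_comm]
          refine Finset.sum_congr rfl fun g _ => Finset.sum_congr rfl fun χ _ => by ring
      _ = 0 := by simp [h0]
  simp_rw [horth] at h
  simpa [hψ] using h

instance IrrChar.finite (G : Type*) [Group G] [Finite G] : Finite (IrrChar G) := by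
  have := (IrrChar.linearIndependent G)
  exact this.finite_of_isNoetherian

noncomputable instance IrrChar.fintype (G : Type*) [Group G] [Finite G] : Fintype (IrrChar G) :=
  Fintype.ofFinite _

/-- The character `χ₀` of the trivial representation: the constant function `1`. -/
def trivialIrrChar (G : Type*) [Group G] : IrrChar G :=
  ⟨fun _ => 1, by
    have h : (Representation.trivial ℂ G ℂ).IsIrreducible := by
      have : IsSimpleOrder (Submodule ℂ ℂ) := inferInstance
      refine @IsSimpleOrder.mk _ _ _ ⟨⊥, ⊤, fun h => ?_⟩ fun a => ?_
      · exact bot_ne_top (congrArg Subrepresentation.toSubmodule h)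
      · refine (eq_bot_or_eq_top a.toSubmodule).imp ?_ ?_ <;>
          exact fun h => Subrepresentation.toSubmodule_injective h
    have := isIrrChar_character _ h
    convert this using 1
    ext g
    simp [Representation.character]⟩

/-- Every character is a nonnegative integer combination of irreducible characters. -/
theorem exists_character_eq_sum {G : Type*} [Group G] [Finite G] (d : ℕ) {V : Type*}
    [AddCommGroup V] [Module ℂ V] [FiniteDimensional ℂ V] (ρ : Representation ℂ G V)
    (hd : Module.finrank ℂ V = d) :
    ∃ m : IrrChar G → ℕ, ρ.character = ∑ χ, (m χ : ℂ) • χ.1 := by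
  classical
  induction d using Nat.strong_induction_on generalizing V with
  | _ d ih =>
    by_cases h0 : d = 0
    · subst h0
      have : Subsingleton V := Module.finrank_zero_iff.1 hd
      refine ⟨0, ?_⟩
      ext g
      have : ρ g = 0 := LinearMap.ext fun v => Subsingleton.elim _ _
      simp [Representation.character, this]
    have hnt : Nontrivial V := Module.nontrivial_of_finrank_pos (R := ℂ) (by omega)
    by_cases hirr : ρ.IsIrreducible
    · refine ⟨Pi.single ⟨_, isIrrChar_character ρ hirr⟩ 1, ?_⟩
      rw [Finset.sum_eq_single ⟨_, isIrrChar_character ρ hirr⟩]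
      · simp
      · intro b _ hb
        simp [Pi.single_eq_of_ne hb]
      · simp
    obtain ⟨W, hW0, hW1⟩ : ∃ W : Subrepresentation ρ, W ≠ ⊥ ∧ W ≠ ⊤ := by
      by_contra! hcon
      refine hirr (@IsSimpleOrder.mk _ _ _ ⟨⊥, ⊤, fun h => ?_⟩ fun a => ?_)
      · exact bot_ne_top (α := Submodule ℂ V) (congrArg Subrepresentation.toSubmodule h)
      · exact or_iff_not_imp_left.2 (hcon a)
    have : NeZero (Nat.card G : ℂ) := ⟨Nat.cast_ne_zero.2 Nat.card_pos.ne'⟩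
    have hss : ComplementedLattice (Subrepresentation ρ) :=
      (inferInstance : ρ.IsSemisimpleRepresentation)
    obtain ⟨U, hU⟩ := exists_isCompl W
    have hinf : W.toSubmodule ⊓ U.toSubmodule = ⊥ :=
      congrArg Subrepresentation.toSubmodule hU.inf_eq_bot
    have hsup : W.toSubmodule ⊔ U.toSubmodule = ⊤ :=
      congrArg Subrepresentation.toSubmodule hU.sup_eq_top
    have hc : IsCompl W.toSubmodule U.toSubmodule :=
      ⟨disjoint_iff.2 hinf, codisjoint_iff.2 hsup⟩
    have hWb : W.toSubmodule ≠ ⊥ := fun h => hW0 (Subrepresentation.toSubmodule_injective h)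
    have hWt : W.toSubmodule ≠ ⊤ := fun h => hW1 (Subrepresentation.toSubmodule_injective h)
    have hadd := Submodule.finrank_add_eq_of_isCompl hc
    have hlt := Submodule.finrank_lt hWt
    have hpos : 0 < Module.finrank ℂ W.toSubmodule := by
      rw [Nat.pos_iff_ne_zero]
      exact fun h => hWb (Submodule.finrank_eq_zero.1 h)
    obtain ⟨a, ha⟩ := ih _ (by omega) W.toRepresentation rfl
    obtain ⟨b, hb⟩ := ih (Module.finrank ℂ U.toSubmodule) (by omega) U.toRepresentation rfl
    refine ⟨a + b, ?_⟩
    have key : ρ.character = W.toRepresentation.character + U.toRepresentation.character := by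
      let f : (W.toRepresentation.prod U.toRepresentation).Equiv ρ :=
        Representation.Equiv.mk (Submodule.prodEquivOfIsCompl _ _ hc) (fun g => by
          ext x <;> simp [Subrepresentation.toRepresentation])
      rw [← Representation.char_iso f]
      ext g
      exact LinearMap.trace_prodMap' _ _
    rw [key, ha, hb, ← Finset.sum_add_distrib]
    refine Finset.sum_congr rfl fun χ _ => ?_
    simp [add_smul]

/-- There is exactly one integer matrix `M` with `χ_γ χ_i = ∑_j M_{ij} χ_j` for all irreducible
characters `χ_i`. -/
theorem existsUnique_mcKayMatrix {G V : Type*} [Group G] [Finite G] [AddCommGroup V] [Module ℂ V]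
    [FiniteDimensional ℂ V] (γ : Representation ℂ G V) :
    ∃! M : Matrix (IrrChar G) (IrrChar G) ℤ,
      ∀ i : IrrChar G, γ.character * i.1 = ∑ j : IrrChar G, (M i j : ℂ) • j.1 := by
  have hex : ∀ i : IrrChar G, ∃ m : IrrChar G → ℕ,
      γ.character * i.1 = ∑ χ, (m χ : ℂ) • χ.1 := by
    rintro ⟨_, k, ρ, hρ, rfl⟩
    obtain ⟨m, hm⟩ := exists_character_eq_sum _ (γ.tprod ρ) rfl
    exact ⟨m, by rw [← hm, Representation.char_tensor]⟩
  choose m hm using hex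
  refine ⟨Matrix.of fun i j => (m i j : ℤ), fun i => by simp [hm i], fun N hN => ?_⟩
  ext i j
  have h : ∑ χ : IrrChar G, ((N i χ : ℂ) - (m i χ : ℂ)) • χ.1 = 0 := by
    simp_rw [sub_smul]
    rw [Finset.sum_sub_distrib, ← hN i, ← hm i, sub_self]
  have h' := Fintype.linearIndependent_iff.1 (IrrChar.linearIndependent G) _ h j
  rw [sub_eq_zero] at h'
  rw [Matrix.of_apply]
  exact_mod_cast h'

/-- The matrix `M` of multiplication by `χ_γ`, defined by `χ_γ χ_i = ∑_j M_{ij} χ_j`. -/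
noncomputable def mcKayMatrix {G V : Type*} [Group G] [Finite G] [AddCommGroup V] [Module ℂ V]
    [FiniteDimensional ℂ V] (γ : Representation ℂ G V) : Matrix (IrrChar G) (IrrChar G) ℤ :=
  (existsUnique_mcKayMatrix γ).choose

theorem mcKayMatrix_spec {G V : Type*} [Group G] [Finite G] [AddCommGroup V] [Module ℂ V]
    [FiniteDimensional ℂ V] (γ : Representation ℂ G V) (i : IrrChar G) :
    γ.character * i.1 = ∑ j : IrrChar G, (mcKayMatrix γ i j : ℂ) • j.1 :=
  (existsUnique_mcKayMatrix γ).choose_spec.1 i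

open Classical in
/-- The extended McKay-Cartan matrix `n I - M`, where `n` is the dimension of `γ`. -/
noncomputable def extendedMcKayCartan {G V : Type*} [Group G] [Finite G] [AddCommGroup V]
    [Module ℂ V] [FiniteDimensional ℂ V] (γ : Representation ℂ G V) :
    Matrix (IrrChar G) (IrrChar G) ℤ :=
  (Module.finrank ℂ V : ℤ) • (1 : Matrix (IrrChar G) (IrrChar G) ℤ) - mcKayMatrix γ

/-- The McKay-Cartan matrix: remove the row and column of the trivial character. -/
noncomputable def mcKayCartan {G V : Type*} [Group G] [Finite G] [AddCommGroup V]
    [Module ℂ V] [FiniteDimensional ℂ V] (γ : Representation ℂ G V) :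
    Matrix {χ : IrrChar G // χ ≠ trivialIrrChar G} {χ : IrrChar G // χ ≠ trivialIrrChar G} ℤ :=
  (extendedMcKayCartan γ).submatrix Subtype.val Subtype.val

noncomputable instance IrrChar.fintypeNontrivial (G : Type*) [Group G] [Finite G] :
    Fintype {χ : IrrChar G // χ ≠ trivialIrrChar G} :=
  Fintype.ofFinite _

/-- The critical group `K(γ)`: the cokernel of the transpose of the McKay-Cartan matrix, acting
on column vectors with integer entries. -/
abbrev CriticalGroup {G V : Type*} [Group G] [Finite G] [AddCommGroup V] [Module ℂ V]
    [FiniteDimensional ℂ V] (γ : Representation ℂ G V) : Type _ :=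
  ({χ : IrrChar G // χ ≠ trivialIrrChar G} → ℤ) ⧸
    LinearMap.range (Matrix.mulVecLin (mcKayCartan γ).transpose)

/-!
The columns of the character table of `G` are eigenvectors of the extended McKay-Cartan matrix
`A = n I - M`: the column at the class of `g` has eigenvalue `n - χ_γ(g)`
(`extendedMcKayCartan_mul_characterTable`). The character table is square and invertible, with
inverse given by the orthogonality relations (`characterTable_mul_inv`, `characterTableInv_mul`);
this rests on the fact that a class function orthogonal to all irreducible characters is zero
(`eq_zero_of_sum_mul_irrChar_eq_zero`).

The determinant of the McKay-Cartan matrix `C` is a diagonal entry of the adjugate of `A`. As `A` is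
diagonalized by the character table `X` and has the eigenvalue `0` at the identity class,
`adj A = X (adj D) X⁻¹` has a single contributing term, and the entry at the trivial character is
`∏ (n - χ_γ(c_i)) / |G|` (`det_mcKayCartan`). So the number in question is the integer `det C`.

It is nonnegative since its factors have nonnegative real parts and are permuted by complex
conjugation (`prod_finrank_sub_character_nonneg`). A factor `n - χ_γ(g)` vanishes exactly when `g`
acts trivially, so the product is nonzero precisely for faithful `γ`
(`prod_finrank_sub_character_ne_zero_iff`), and then the cokernel of `Cᵗ` has `|det C|` elements
(`Matrix.natAbs_det_eq_card_coker`).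
-/

/-! ### Adjugates and cokernels of matrices -/

theorem Matrix.adjugate_apply_self_eq_det_submatrix {ι R : Type*} [Fintype ι] [DecidableEq ι]
    [CommRing R] (A : Matrix ι ι R) (i : ι) :
    A.adjugate i i =
      (A.submatrix (Subtype.val : {j // j ≠ i} → ι) (Subtype.val : {j // j ≠ i} → ι)).det := by
  rw [Matrix.adjugate_apply, Matrix.twoBlockTriangular_det' _ (fun j => j = i)]
  · rw [show (A.updateRow i (Pi.single i 1)).toSquareBlockProp (fun j => j = i) = 1 by
      ext ⟨j, hj⟩ ⟨k, hk⟩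
      subst hj hk
      simp [Matrix.toSquareBlockProp_def], @Matrix.det_one _ _ (_) (_), one_mul]
    congr 1
    ext j k
    simp [Matrix.toSquareBlockProp_def, Matrix.updateRow_ne j.2]
  · rintro j rfl k hk
    simp [hk]

/-- The cokernel of a nonsingular integer matrix has `|det A|` elements. -/
theorem Matrix.natAbs_det_eq_card_coker {ι : Type*} [Fintype ι] [DecidableEq ι]
    (A : Matrix ι ι ℤ) (hA : A.det ≠ 0) :
    A.det.natAbs = Nat.card ((ι → ℤ) ⧸ LinearMap.range A.mulVecLin) := by
  have hinj : Function.Injective A.mulVecLin := Matrix.mulVec_injective_of_det_ne_zero hA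
  rw [← Submodule.natAbs_det_equiv _ (LinearEquiv.ofInjective A.mulVecLin hinj),
    ← LinearMap.det_toLin']
  congr 2

/-- The diagonal entries of the adjugate of a matrix that is diagonalized by `X`, with a zero among
the eigenvalues. The columns of `X` are eigenvectors and `Y` is its inverse; since
`adj A = X (adj D) Y` and `adj D` is supported at the entry `(i₀, i₀)`, one term survives. -/
theorem Matrix.adjugate_apply_self_of_mul_eq {m ι R : Type*} [Fintype m] [DecidableEq m]
    [Fintype ι] [DecidableEq ι] [CommRing R] [Nontrivial R] (A : Matrix m m R)
    (X : Matrix m ι R) (Y : Matrix ι m R)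
    (hXY : X * Y = 1) (hYX : Y * X = 1) (d : ι → R) (hA : A * X = X * Matrix.diagonal d)
    (i₀ : ι) (h0 : d i₀ = 0) (j : m) :
    A.adjugate j j = X j i₀ * (∏ i ∈ Finset.univ.erase i₀, d i) * Y i₀ j := by
  let e : m ≃ ι := Fintype.equivOfCardEq (Matrix.square_of_invertible X Y hXY hYX)
  let P : Matrix m m R := X.submatrix id e
  let Q : Matrix m m R := Y.submatrix e id
  have hPQ : P * Q = 1 := by
    rw [← Matrix.submatrix_id_id (1 : Matrix m m R), ← hXY]
    exact Matrix.submatrix_mul_equiv X Y id e id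
  have hA' : A = P * (Matrix.diagonal d).submatrix e e * Q := by
    have h1 : P * (Matrix.diagonal d).submatrix e e = A * P := by
      rw [Matrix.submatrix_mul_equiv, ← hA]
      rfl
    rw [h1, Matrix.mul_assoc, hPQ, Matrix.mul_one]
  have hdet : P.det * Q.det = 1 := by rw [← Matrix.det_mul, hPQ, Matrix.det_one]
  have hP : P.adjugate = P.det • Q := by
    calc P.adjugate = P.adjugate * (P * Q) := by rw [hPQ, Matrix.mul_one]
      _ = P.det • Q := by rw [← Matrix.mul_assoc, Matrix.adjugate_mul]; simp
  have hQ : Q.adjugate = Q.det • P := by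
    calc Q.adjugate = (P * Q) * Q.adjugate := by rw [hPQ, Matrix.one_mul]
      _ = Q.det • P := by rw [Matrix.mul_assoc, Matrix.mul_adjugate]; simp
  have hadj : A.adjugate = P * (Matrix.diagonal d).adjugate.submatrix e e * Q := by
    rw [hA', Matrix.adjugate_mul_distrib, Matrix.adjugate_mul_distrib, hP, hQ,
      Matrix.adjugate_submatrix_equiv_self, Matrix.smul_mul, Matrix.mul_smul, Matrix.mul_smul,
      smul_smul, mul_comm, hdet, one_smul, Matrix.mul_assoc]
  have hD : (Matrix.diagonal d).adjugate =
      Matrix.diagonal (Pi.single i₀ (∏ i ∈ Finset.univ.erase i₀, d i)) := by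
    rw [Matrix.adjugate_diagonal]
    congr 1
    ext i
    obtain rfl | hi := eq_or_ne i i₀
    · rw [Pi.single_eq_same]
    · rw [Pi.single_eq_of_ne hi]
      exact Finset.prod_eq_zero (Finset.mem_erase.2 ⟨hi.symm, Finset.mem_univ _⟩) h0
  rw [hadj, Matrix.submatrix_mul_equiv, Matrix.submatrix_mul_equiv, Matrix.submatrix_id_id, hD,
    Matrix.mul_apply, Finset.sum_eq_single i₀]
  · simp [Matrix.mul_diagonal]
  · intro i _ hi
    simp [Matrix.mul_diagonal, hi]
  · simp

/-! ### Products stable under conjugation -/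

/-- A product of complex numbers with nonnegative real parts is a nonnegative real number if
conjugation permutes the factors. Along the segment from `1` to `z i` all real parts stay positive,
so the product, which is real throughout, cannot change sign. -/
theorem Complex.prod_eq_nonneg_of_conj {ι : Type*} [Fintype ι] (σ : Equiv.Perm ι) (z : ι → ℂ)
    (hσ : ∀ i, z (σ i) = starRingEnd ℂ (z i)) (hz : ∀ i, 0 ≤ (z i).re) :
    ∃ r : ℝ, 0 ≤ r ∧ ∏ i, z i = r := by
  let f : ℝ → ℂ := fun s => ∏ i, ((1 - s : ℝ) + (s : ℂ) * z i)
  have hreal : ∀ s, (f s).im = 0 := fun s => by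
    rw [← Complex.conj_eq_iff_im, map_prod, ← Equiv.prod_comp σ]
    refine Finset.prod_congr rfl fun i _ => ?_
    simp [hσ]
  have hf : ∀ s, f s = ((f s).re : ℝ) := fun s => Complex.ext rfl (by simp [hreal])
  have hcont : Continuous fun s => (f s).re := by fun_prop
  have h1 : f 1 = ∏ i, z i := by simp [f]
  refine ⟨(f 1).re, ?_, by rw [← hf, h1]⟩
  by_contra! hneg
  obtain ⟨s, ⟨hs0, hs1⟩, hs⟩ := intermediate_value_Icc' (zero_le_one' ℝ) hcont.continuousOn
    (show (0 : ℝ) ∈ Set.Icc (f 1).re (f 0).re from ⟨hneg.le, by simp [f]⟩)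
  obtain rfl | hs1 := hs1.eq_or_lt
  · exact hneg.ne hs
  have h0 : f s = 0 := by rw [hf]; exact_mod_cast hs
  obtain ⟨i, -, hi⟩ := Finset.prod_eq_zero_iff.1 h0
  have := congrArg Complex.re hi
  simp at this
  nlinarith [mul_nonneg hs0 (hz i)]

/-! ### Eigenvalues and values of characters -/

/-- An endomorphism of finite order is diagonalizable, since `X ^ m - 1` is squarefree over `ℂ`. -/
theorem Module.End.exists_eigenbasis_of_pow_eq_one {V : Type*} [AddCommGroup V] [Module ℂ V]
    [FiniteDimensional ℂ V] (f : Module.End ℂ V) {m : ℕ} (hm : m ≠ 0) (hf : f ^ m = 1) :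
    ∃ (b : Module.Basis (Fin (Module.finrank ℂ V)) ℂ V) (μ : Fin (Module.finrank ℂ V) → ℂ),
      ∀ i, f (b i) = μ i • b i := by
  have hss : f.IsSemisimple := by
    refine Module.End.isSemisimple_of_squarefree_aeval_eq_zero (p := Polynomial.X ^ m - 1)
      (Polynomial.Separable.squarefree ?_) (by simp [hf])
    simpa using Polynomial.separable_X_pow_sub_C (1 : ℂ) (Nat.cast_ne_zero.2 hm) one_ne_zero
  have hint : DirectSum.IsInternal f.eigenspace :=
    DirectSum.isInternal_submodule_of_iSupIndep_of_iSup_eq_top f.eigenspaces_iSupIndep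
      hss.iSup_eigenspace_eq_top
  let B := hint.collectedBasis fun μ => Module.finBasis ℂ (f.eigenspace μ)
  have := Module.Finite.finite_basis B
  have := Fintype.ofFinite (Σ μ : ℂ, Fin (Module.finrank ℂ (f.eigenspace μ)))
  let e := Fintype.equivFinOfCardEq (Module.finrank_eq_card_basis B).symm
  refine ⟨B.reindex e, fun i => (e.symm i).1, fun i => ?_⟩
  rw [Module.Basis.reindex_apply]
  exact Module.End.mem_eigenspace_iff.1 (hint.collectedBasis_mem _ _)

theorem LinearMap.trace_eq_sum_of_apply_basis {ι K V : Type*} [Fintype ι] [Field K]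
    [AddCommGroup V] [Module K V] (b : Module.Basis ι K V) (f : Module.End K V) (μ : ι → K)
    (h : ∀ i, f (b i) = μ i • b i) : LinearMap.trace K V f = ∑ i, μ i := by
  classical
  rw [LinearMap.trace_eq_matrix_trace K b, Matrix.trace]
  simp [LinearMap.toMatrix_apply, h]

section
variable {G V : Type*} [Group G] [Finite G] [AddCommGroup V] [Module ℂ V]
  [FiniteDimensional ℂ V] (ρ : Representation ℂ G V)

theorem Representation.exists_eigenbasis (g : G) :
    ∃ (b : Module.Basis (Fin (Module.finrank ℂ V)) ℂ V) (μ : Fin (Module.finrank ℂ V) → ℂ),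
      (∀ i, ‖μ i‖ = 1) ∧ (∀ i, ρ g (b i) = μ i • b i) ∧ ∀ i, ρ g⁻¹ (b i) = (μ i)⁻¹ • b i := by
  have hm : orderOf g ≠ 0 := (orderOf_pos g).ne'
  have hpow : ρ g ^ orderOf g = 1 := by rw [← map_pow, pow_orderOf_eq_one, map_one]
  obtain ⟨b, μ, h⟩ := Module.End.exists_eigenbasis_of_pow_eq_one (ρ g) hm hpow
  have hk : ∀ i (k : ℕ), (ρ g ^ k) (b i) = μ i ^ k • b i := fun i k => by
    induction k with
    | zero => simp
    | succ k ih => rw [pow_succ', Module.End.mul_apply, ih, map_smul, h, smul_smul, pow_succ]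
  have hμ : ∀ i, μ i ^ orderOf g = 1 := fun i => by
    have := hk i (orderOf g)
    rw [hpow, Module.End.one_apply] at this
    exact smul_left_injective ℂ (b.ne_zero i) (by simpa using this.symm)
  have hμ0 : ∀ i, μ i ≠ 0 := fun i h0 => by simpa [h0, hm] using hμ i
  refine ⟨b, μ, fun i => Complex.norm_eq_one_of_pow_eq_one (hμ i) hm, h, fun i => ?_⟩
  rw [eq_inv_smul_iff₀ (hμ0 i), ← map_smul, ← h, ← Module.End.mul_apply, ← map_mul]
  simp

theorem Representation.character_inv_eq_conj (g : G) :
    ρ.character g⁻¹ = starRingEnd ℂ (ρ.character g) := by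
  obtain ⟨b, μ, hμ, h, h'⟩ := ρ.exists_eigenbasis g
  rw [Representation.character, Representation.character,
    LinearMap.trace_eq_sum_of_apply_basis b _ _ h,
    LinearMap.trace_eq_sum_of_apply_basis b _ _ h', map_sum]
  exact Finset.sum_congr rfl fun i _ => Complex.inv_eq_conj (hμ i)

theorem Representation.re_character_le (g : G) :
    (ρ.character g).re ≤ Module.finrank ℂ V := by
  obtain ⟨b, μ, hμ, h, -⟩ := ρ.exists_eigenbasis g
  rw [Representation.character, LinearMap.trace_eq_sum_of_apply_basis b _ _ h, Complex.re_sum]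
  refine (Finset.sum_le_sum fun i _ => (Complex.re_le_norm _).trans (hμ i).le).trans ?_
  simp

/-- The kernel of a representation is detected by its character: a sum of `n` numbers of absolute
value `1` equals `n` only if all of them are `1`. -/
theorem Representation.character_eq_finrank_iff (g : G) :
    ρ.character g = Module.finrank ℂ V ↔ ρ g = 1 := by
  refine ⟨fun hg => ?_, fun hg => by rw [Representation.character, hg, LinearMap.trace_one]⟩
  obtain ⟨b, μ, hμ, h, -⟩ := ρ.exists_eigenbasis g
  rw [Representation.character, LinearMap.trace_eq_sum_of_apply_basis b _ _ h] at hg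
  have hre : ∑ i, (1 - (μ i).re) = 0 := by
    have := congrArg Complex.re hg
    rw [Complex.re_sum] at this
    simp [this]
  have hnn : ∀ i, 0 ≤ 1 - (μ i).re := fun i =>
    sub_nonneg.2 ((Complex.re_le_norm _).trans (hμ i).le)
  refine b.ext fun i => ?_
  have h1 : (μ i).re = 1 := by
    have := (Finset.sum_eq_zero_iff_of_nonneg fun i _ => hnn i).1 hre i (Finset.mem_univ i)
    linarith
  have h2 : μ i = 1 := by
    have h3 := Complex.sq_norm (μ i)
    rw [hμ i, Complex.normSq_apply, h1] at h3
    exact Complex.ext h1 (by simpa using h3)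
  rw [h, h2, one_smul, Module.End.one_apply]
end

/-! ### Orthogonality and completeness of irreducible characters -/

theorem IsIrrChar.conj {G : Type*} [Group G] {χ : G → ℂ} (hχ : IsIrrChar χ) (g h : G) :
    χ (h * g * h⁻¹) = χ g := by
  obtain ⟨m, ρ, -, rfl⟩ := hχ
  exact ρ.char_conj g h

theorem IrrChar.orthonormal {G : Type*} [Group G] [Finite G] [Fintype G] [DecidableEq (IrrChar G)]
    (χ ψ : IrrChar G) :
    (Nat.card G : ℂ)⁻¹ * ∑ g : G, χ.1 g * ψ.1 g⁻¹ = if χ = ψ then 1 else 0 := by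
  classical
  have := invertibleOfNonzero (Nat.cast_ne_zero.2 Nat.card_pos.ne' : (Nat.card G : ℂ) ≠ 0)
  obtain ⟨_, m, ρ, hρ, rfl⟩ := χ
  obtain ⟨_, k, σ, hσ, rfl⟩ := ψ
  split_ifs with h
  · have h1 := Representation.char_orthonormal ρ ρ
    rw [if_pos ⟨Representation.Equiv.refl ρ⟩] at h1
    have h2 : σ.character = ρ.character := congrArg Subtype.val h.symm
    simpa only [h2] using h1
  · rw [Representation.char_orthonormal ρ σ, if_neg]
    exact fun ⟨e⟩ => h (Subtype.ext (Representation.char_iso e).symm)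

section
variable {G V : Type*} [Group G] [Fintype G] [AddCommGroup V] [Module ℂ V]
  [FiniteDimensional ℂ V] (ρ : Representation ℂ G V)

omit [FiniteDimensional ℂ V] in
theorem Representation.trace_sum_smul (f : G → ℂ) :
    LinearMap.trace ℂ V (∑ g, f g • ρ g) = ∑ g, f g * ρ.character g := by
  simp [Representation.character]

/-- For a class function `f` the operator `∑ f(g) ρ(g)` is equivariant, hence a scalar by Schur's
lemma, and its trace determines it. -/
theorem Representation.sum_smul_eq_zero_of_isIrreducible (h : ρ.IsIrreducible) (f : G → ℂ)
    (hf : ∀ g h, f (h * g * h⁻¹) = f g) (hχ : ∑ g, f g * ρ.character g = 0) :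
    ∑ g, f g • ρ g = 0 := by
  have hcomm : ∀ x, (∑ g, f g • ρ g) ∘ₗ ρ x = ρ x ∘ₗ ∑ g, f g • ρ g := fun x => by
    change (∑ g, f g • ρ g) * ρ x = ρ x * ∑ g, f g • ρ g
    rw [Finset.sum_mul, Finset.mul_sum, ← (MulAut.conj x).toEquiv.sum_comp]
    refine Finset.sum_congr rfl fun g _ => ?_
    simp [hf, ← map_mul]
  let T : Representation.IntertwiningMap ρ ρ := ⟨∑ g, f g • ρ g, hcomm⟩
  obtain ⟨a, ha⟩ :=
    Representation.IsIrreducible.algebraMap_intertwiningMap_bijective_of_isAlgClosed.2 T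
  have hT : ∑ g, f g • ρ g = a • (1 : Module.End ℂ V) := by
    have := congrArg Representation.IntertwiningMap.toLinearMap ha
    rw [Algebra.algebraMap_eq_smul_one] at this
    exact this.symm
  have htr := ρ.trace_sum_smul f
  rw [hχ, hT, map_smul, LinearMap.trace_one, smul_eq_mul, mul_eq_zero] at htr
  obtain rfl | h0 := htr
  · rw [hT, zero_smul]
  · have : Subsingleton V := Module.finrank_zero_iff.1 (Nat.cast_eq_zero.1 h0)
    exact Subsingleton.elim _ _

/-- A class function orthogonal to all irreducible characters acts by zero on every
finite-dimensional representation, by complete reducibility. -/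
theorem Representation.sum_smul_eq_zero (f : G → ℂ) (hf : ∀ g h, f (h * g * h⁻¹) = f g)
    (hχ : ∀ χ : IrrChar G, ∑ g, f g * χ.1 g = 0) : ∑ g, f g • ρ g = 0 := by
  induction hd : Module.finrank ℂ V using Nat.strong_induction_on generalizing V with
  | _ d ih =>
    by_cases hirr : ρ.IsIrreducible
    · exact ρ.sum_smul_eq_zero_of_isIrreducible hirr f hf (hχ ⟨_, isIrrChar_character ρ hirr⟩)
    by_cases hs : Subsingleton V
    · exact Subsingleton.elim _ _
    rw [not_subsingleton_iff_nontrivial] at hs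
    obtain ⟨W, hW0, hW1⟩ : ∃ W : Subrepresentation ρ, W ≠ ⊥ ∧ W ≠ ⊤ := by
      by_contra! hcon
      exact hirr (@IsSimpleOrder.mk _ _ _ ⟨⊥, ⊤, fun h => bot_ne_top (α := Submodule ℂ V)
        (congrArg Subrepresentation.toSubmodule h)⟩ fun a => or_iff_not_imp_left.2 (hcon a))
    have : NeZero (Nat.card G : ℂ) := ⟨Nat.cast_ne_zero.2 Nat.card_pos.ne'⟩
    have : ComplementedLattice (Subrepresentation ρ) :=
      (inferInstance : ρ.IsSemisimpleRepresentation)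
    obtain ⟨U, hU⟩ := exists_isCompl W
    have hker : ∀ W : Subrepresentation ρ, W ≠ ⊤ → ∀ w ∈ W.toSubmodule,
        (∑ g, f g • ρ g) w = 0 := fun W hW w hw => by
      have hlt := Submodule.finrank_lt fun h => hW (Subrepresentation.toSubmodule_injective h)
      have h := LinearMap.congr_fun (ih _ (hd ▸ hlt) W.toRepresentation rfl) ⟨w, hw⟩
      have h' := congrArg Subtype.val h
      simpa [LinearMap.sum_apply, Subrepresentation.toRepresentation] using h'
    have hU1 : U ≠ ⊤ := fun h => hW0 (by simpa [h] using hU.inf_eq_bot)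
    ext v
    have hsup : W.toSubmodule ⊔ U.toSubmodule = ⊤ :=
      congrArg Subrepresentation.toSubmodule hU.sup_eq_top
    obtain ⟨w, hw, u, hu, rfl⟩ := Submodule.mem_sup.1 (hsup ▸ Submodule.mem_top : v ∈ _)
    rw [map_add, hker W hW1 w hw, hker U hU1 u hu, add_zero, LinearMap.zero_apply]

end

/-- The irreducible characters span the class functions, in the form: a class function orthogonal to
all of them vanishes. It acts by zero on the regular representation, and its coefficients are read
off from the image of the identity element. -/
theorem eq_zero_of_sum_mul_irrChar_eq_zero {G : Type*} [Group G] [Fintype G] (f : G → ℂ)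
    (hf : ∀ g h, f (h * g * h⁻¹) = f g) (hχ : ∀ χ : IrrChar G, ∑ g, f g * χ.1 g = 0) :
    f = 0 := by
  classical
  have h := (Representation.leftRegular ℂ G).sum_smul_eq_zero f hf hχ
  ext x
  have h' := congrArg (fun a => a.coeff x)
    (LinearMap.congr_fun h (MonoidAlgebra.single (1 : G) (1 : ℂ)))
  simpa [LinearMap.sum_apply, Finsupp.single_apply] using h'

/-! ### The character table -/

section
variable {G ι : Type*} [Group G] {c : ι → G}
  (hc : Function.Bijective fun i => ConjClasses.mk (c i))

/-- The index of the representative, among the `c i`, of the conjugacy class of `g`. -/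
noncomputable def classIndex (g : G) : ι :=
  (Equiv.ofBijective _ hc).symm (ConjClasses.mk g)

theorem isConj_classIndex (g : G) : IsConj (c (classIndex hc g)) g :=
  ConjClasses.mk_eq_mk_iff_isConj.1 ((Equiv.ofBijective _ hc).apply_symm_apply _)

theorem classIndex_eq_of_isConj {i : ι} {g : G} (h : IsConj (c i) g) : classIndex hc g = i := by
  rw [classIndex, Equiv.symm_apply_eq]
  exact (ConjClasses.mk_eq_mk_iff_isConj.2 h).symm

theorem apply_classIndex {α : Type*} (F : G → α) (hF : ∀ g h, F (h * g * h⁻¹) = F g) (g : G) :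
    F (c (classIndex hc g)) = F g := by
  obtain ⟨h, hh⟩ := isConj_iff.1 (isConj_classIndex hc g)
  exact (hF _ h).symm.trans (congrArg F hh)

theorem classIndex_conj (g h : G) : classIndex hc (h * g * h⁻¹) = classIndex hc g := by
  refine classIndex_eq_of_isConj hc ((isConj_classIndex hc g).trans (isConj_iff.2 ⟨h, rfl⟩))

/-- The number of elements of the conjugacy class represented by `c i`. -/
noncomputable def classSize [Fintype G] [DecidableEq ι] (i : ι) : ℕ :=
  (Finset.univ.filter fun g => classIndex hc g = i).card

variable [Fintype G] [DecidableEq ι]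

theorem classSize_ne_zero (i : ι) : classSize hc i ≠ 0 :=
  Finset.card_ne_zero.2 ⟨c i, by simpa using classIndex_eq_of_isConj hc (IsConj.refl _)⟩

theorem classSize_eq_one {i : ι} (hi : c i = 1) : classSize hc i = 1 := by
  rw [classSize, Finset.card_eq_one]
  refine ⟨1, Finset.ext fun g => ?_⟩
  rw [Finset.mem_filter_univ, Finset.mem_singleton]
  constructor
  · rintro rfl
    simpa [hi, isConj_iff, eq_comm] using isConj_classIndex hc g
  · rintro rfl
    exact classIndex_eq_of_isConj hc (hi ▸ IsConj.refl _)

theorem sum_eq_sum_classSize_mul [Fintype ι] (F : G → ℂ) (hF : ∀ g h, F (h * g * h⁻¹) = F g) :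
    ∑ g, F g = ∑ i, classSize hc i * F (c i) := by
  rw [← Finset.sum_fiberwise Finset.univ (classIndex hc)]
  refine Finset.sum_congr rfl fun i _ => ?_
  rw [classSize, ← nsmul_eq_mul]
  refine Finset.sum_eq_card_nsmul fun g hg => ?_
  rw [← (Finset.mem_filter.1 hg).2, apply_classIndex hc F hF]

/-- The character table: rows are irreducible characters, columns are the chosen class
representatives. -/
def characterTable (c : ι → G) : Matrix (IrrChar G) ι ℂ :=
  Matrix.of fun χ i => χ.1 (c i)

/-- The inverse of the character table, with entries `|class of c i| / |G| * χ (c i)⁻¹`, where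
`χ (c i)⁻¹` is the value of `χ` at the inverse of `c i`, as prescribed by the orthogonality
relations. -/
noncomputable def characterTableInv : Matrix ι (IrrChar G) ℂ :=
  Matrix.of fun i χ => (Nat.card G : ℂ)⁻¹ * (classSize hc i * χ.1 (c i)⁻¹)

variable [Fintype ι]

theorem characterTable_mul_inv [DecidableEq (IrrChar G)] :
    characterTable c * characterTableInv hc = 1 := by
  ext χ ψ
  rw [Matrix.one_apply, ← IrrChar.orthonormal, sum_eq_sum_classSize_mul hc, Matrix.mul_apply,
    Finset.mul_sum]
  · refine Finset.sum_congr rfl fun i _ => ?_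
    simp only [characterTable, characterTableInv, Matrix.of_apply]
    ring
  · intro g h
    rw [χ.2.conj, ← ψ.2.conj g⁻¹ h]
    congr 2
    group

include hc in
theorem characterTable_mulVec_injective :
    Function.Injective (characterTable c).mulVec := by
  refine (injective_iff_map_eq_zero (characterTable c).mulVecLin).2 fun v hv => ?_
  have hs : ∀ i, (classSize hc i : ℂ) ≠ 0 := fun i => Nat.cast_ne_zero.2 (classSize_ne_zero hc i)
  -- A kernel vector of the character table is, after division by the class sizes, a class function
  -- orthogonal to all irreducible characters.
  let f : G → ℂ := fun g => v (classIndex hc g) / classSize hc (classIndex hc g)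
  have hf : ∀ g h, f (h * g * h⁻¹) = f g := fun g h => by simp only [f, classIndex_conj]
  have h0 : f = 0 := by
    refine eq_zero_of_sum_mul_irrChar_eq_zero f hf fun χ => ?_
    rw [sum_eq_sum_classSize_mul hc _ fun g h => by rw [hf, χ.2.conj]]
    refine Eq.trans ?_ (congrFun hv χ)
    refine Finset.sum_congr rfl fun i _ => ?_
    simp only [f, characterTable, classIndex_eq_of_isConj hc (IsConj.refl (c i)), Matrix.of_apply]
    field_simp [hs i]
  ext i
  have := congrFun h0 (c i)
  simpa [f, hs, classIndex_eq_of_isConj hc (IsConj.refl (c i))] using this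

/-- The character table is also left invertible by its right inverse because it is injective; in
particular there are as many irreducible characters as conjugacy classes. -/
theorem characterTableInv_mul : characterTableInv hc * characterTable c = 1 := by
  classical
  refine Matrix.ext_of_mulVec_single fun i => characterTable_mulVec_injective hc ?_
  rw [← Matrix.mulVec_mulVec, Matrix.mulVec_mulVec, characterTable_mul_inv, Matrix.one_mulVec,
    Matrix.one_mulVec]

end

/-! ### The McKay-Cartan matrix -/

/-- The columns of the character table are eigenvectors of the extended McKay-Cartan matrix. -/
theorem extendedMcKayCartan_mul_characterTable {G V ι : Type*} [Group G] [Finite G]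
    [AddCommGroup V] [Module ℂ V] [FiniteDimensional ℂ V] [Fintype ι] [DecidableEq ι]
    (γ : Representation ℂ G V) (c : ι → G) :
    (extendedMcKayCartan γ).map (Int.cast : ℤ → ℂ) * characterTable c =
      characterTable c *
        Matrix.diagonal fun i => (Module.finrank ℂ V : ℂ) - γ.character (c i) := by
  classical
  ext χ i
  have h := congrFun (mcKayMatrix_spec γ χ) (c i)
  rw [Matrix.mul_diagonal, Matrix.mul_apply]
  simp only [Pi.mul_apply, Finset.sum_apply, Pi.smul_apply, smul_eq_mul] at h
  simp only [extendedMcKayCartan, characterTable, Matrix.map_apply, Matrix.sub_apply,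
    Matrix.smul_apply, Matrix.of_apply, Int.cast_sub, sub_mul, Finset.sum_sub_distrib, ← h]
  simp [Matrix.one_apply]
  ring

section
variable {G V : Type*} [Group G] [Finite G] [AddCommGroup V] [Module ℂ V]
  [FiniteDimensional ℂ V] (γ : Representation ℂ G V) {ℓ : ℕ} (c : Fin (ℓ + 1) → G)
  (hc0 : c 0 = 1) (hc : Function.Bijective fun i => ConjClasses.mk (c i))

include hc0 hc

/-- The determinant of the McKay-Cartan matrix is the diagonal entry of the adjugate of `n I - M` at
the trivial character, where the eigenvector for the eigenvalue `0` has the entry `1` and the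
corresponding row of the inverse character table has the entry `1 / |G|`. -/
theorem det_mcKayCartan [DecidableEq (IrrChar G)] :
    ((mcKayCartan γ).det : ℂ) =
      (Nat.card G : ℂ)⁻¹ * ∏ i : Fin ℓ, ((Module.finrank ℂ V : ℂ) - γ.character (c i.succ)) := by
  have := Fintype.ofFinite G
  have h := Matrix.adjugate_apply_self_of_mul_eq _ _ _ (characterTable_mul_inv hc)
    (characterTableInv_mul hc) _ (extendedMcKayCartan_mul_characterTable γ c) 0
    (by rw [hc0, Representation.char_one, sub_self]) (trivialIrrChar G)
  rw [Matrix.adjugate_apply_self_eq_det_submatrix] at h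
  have hdet : ((mcKayCartan γ).det : ℂ) = ((mcKayCartan γ).map (Int.cast : ℤ → ℂ)).det :=
    (Int.castRingHom ℂ).map_det _
  have hprod : ∀ d : Fin (ℓ + 1) → ℂ, ∏ i ∈ Finset.univ.erase 0, d i = ∏ i : Fin ℓ, d i.succ := by
    intro d
    rw [Fin.univ_succ, Finset.erase_cons, Finset.prod_map]
    rfl
  have hX : characterTable c (trivialIrrChar G) 0 = 1 := rfl
  have hY : characterTableInv hc 0 (trivialIrrChar G) = (Nat.card G : ℂ)⁻¹ := by
    simp [characterTableInv, classSize_eq_one hc hc0, trivialIrrChar]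
  rw [hX, hY, one_mul, hprod, mul_comm] at h
  rw [hdet, ← h]
  convert rfl
  rfl

/-- Conjugation permutes the factors because `χ(g⁻¹)` is the conjugate of `χ(g)`. -/
theorem prod_finrank_sub_character_nonneg :
    ∃ r : ℝ, 0 ≤ r ∧
      ∏ i : Fin ℓ, ((Module.finrank ℂ V : ℂ) - γ.character (c i.succ)) = r := by
  let τ : Fin (ℓ + 1) → Fin (ℓ + 1) := fun i => classIndex hc (c i)⁻¹
  have hconj : ∀ i, IsConj (c (τ i)) (c i)⁻¹ := fun i => isConj_classIndex hc _
  have hinv : Function.Involutive τ := fun i => by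
    refine classIndex_eq_of_isConj hc ?_
    obtain ⟨h, hh⟩ := isConj_iff.1 (hconj i)
    refine (isConj_iff.2 ⟨h, ?_⟩ : IsConj (c (τ i))⁻¹ (c i)).symm
    rw [← inv_inj, ← hh]
    group
  have hτ0 : τ 0 = 0 := classIndex_eq_of_isConj hc (by rw [hc0, inv_one])
  -- The factor `0` at the identity class is replaced by `1`, so that inversion of classes permutes
  -- all of `Fin (ℓ + 1)`.
  let z : Fin (ℓ + 1) → ℂ :=
    Fin.cons 1 fun i => (Module.finrank ℂ V : ℂ) - γ.character (c i.succ)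
  have hz : ∀ i, i ≠ 0 → z i = (Module.finrank ℂ V : ℂ) - γ.character (c i) := by
    intro i hi
    obtain ⟨j, rfl⟩ := Fin.exists_succ_eq.2 hi
    rfl
  obtain ⟨r, hr, h⟩ := Complex.prod_eq_nonneg_of_conj hinv.toPerm z
    (fun i => by
      rw [Function.Involutive.coe_toPerm]
      by_cases hi : i = 0
      · simp [hi, hτ0, z]
      · have hτi : τ i ≠ 0 := fun h => hi (by rw [← hinv i, h, hτ0])
        obtain ⟨h, hh⟩ := isConj_iff.1 (hconj i)
        rw [hz _ hi, hz _ hτi, ← γ.char_conj _ h, hh, γ.character_inv_eq_conj]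
        simp)
    (fun i => by
      by_cases hi : i = 0
      · simp [hi, z]
      · simpa [hz _ hi] using γ.re_character_le (c i))
  refine ⟨r, hr, ?_⟩
  rw [← h, Fin.prod_univ_succ]
  simp [z]

theorem prod_finrank_sub_character_ne_zero_iff :
    ∏ i : Fin ℓ, ((Module.finrank ℂ V : ℂ) - γ.character (c i.succ)) ≠ 0 ↔
      Function.Injective γ := by
  rw [Finset.prod_ne_zero_iff, injective_iff_map_eq_one]
  simp only [Finset.mem_univ, true_imp_iff, sub_ne_zero]
  constructor
  · intro h g hg
    by_cases hi : classIndex hc g = 0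
    · simpa [hi, hc0, isConj_iff, eq_comm] using isConj_classIndex hc g
    · obtain ⟨j, hj⟩ := Fin.exists_succ_eq.2 hi
      refine absurd ?_ (h j)
      rw [hj, apply_classIndex hc γ.character γ.char_conj, (γ.character_eq_finrank_iff g).2 hg]
  · intro h i hi
    have h1 : c i.succ = 1 := h _ ((γ.character_eq_finrank_iff _).1 hi.symm)
    exact Fin.succ_ne_zero i (hc.1 (by simp only [h1, hc0]))

end

theorem mainTheorem5 {G : Type*} [Group G] [Finite G]
    {V : Type*} [AddCommGroup V] [Module ℂ V] [FiniteDimensional ℂ V]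
    (γ : Representation ℂ G V) (n : ℕ) (hn : Module.finrank ℂ V = n)
    (ℓ : ℕ) (c : Fin (ℓ + 1) → G) (hc0 : c 0 = 1)
    (hc : Function.Bijective (fun i => ConjClasses.mk (c i))) :
    (∃ k : ℕ, (1 / (Nat.card G : ℂ)) * ∏ i : Fin ℓ, ((n : ℂ) - γ.character (c i.succ)) = k) ∧
    (Function.Injective γ →
      Finite (CriticalGroup γ) ∧
      (1 / (Nat.card G : ℂ)) * ∏ i : Fin ℓ, ((n : ℂ) - γ.character (c i.succ)) =
        (Nat.card (CriticalGroup γ) : ℂ)) ∧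
    (¬ Function.Injective γ →
      (1 / (Nat.card G : ℂ)) * ∏ i : Fin ℓ, ((n : ℂ) - γ.character (c i.succ)) = 0) := by
  classical
  subst hn
  have hdet := det_mcKayCartan γ c hc0 hc
  have hfaithful := prod_finrank_sub_character_ne_zero_iff γ c hc0 hc
  have hnonneg : 0 ≤ (mcKayCartan γ).det := by
    obtain ⟨r, hr, h⟩ := prod_finrank_sub_character_nonneg γ c hc0 hc
    have h' : ((mcKayCartan γ).det : ℝ) = (Nat.card G : ℝ)⁻¹ * r := by
      rw [h] at hdet
      apply Complex.ofReal_injective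
      rw [Complex.ofReal_intCast, Complex.ofReal_mul, Complex.ofReal_inv, Complex.ofReal_natCast]
      exact hdet
    rw [← Int.cast_nonneg_iff (R := ℝ), h']
    positivity
  have habs : (1 / (Nat.card G : ℂ)) *
      ∏ i : Fin ℓ, ((Module.finrank ℂ V : ℂ) - γ.character (c i.succ)) =
        ((mcKayCartan γ).det.natAbs : ℂ) := by
    rw [one_div, ← hdet, Nat.cast_natAbs, abs_of_nonneg hnonneg]
  refine ⟨⟨_, habs⟩, fun hγ => ?_, fun hγ => ?_⟩
  · have hne : (mcKayCartan γ).det ≠ 0 := fun h0 => by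
      rw [h0, Int.cast_zero, eq_comm] at hdet
      exact mul_ne_zero (inv_ne_zero (Nat.cast_ne_zero.2 Nat.card_pos.ne'))
        (hfaithful.2 hγ) hdet
    have hcard : (mcKayCartan γ).det.natAbs = Nat.card (CriticalGroup γ) := by
      rw [← Matrix.det_transpose] at hne ⊢
      exact Matrix.natAbs_det_eq_card_coker _ hne
    exact ⟨Nat.finite_of_card_ne_zero (hcard ▸ Int.natAbs_ne_zero.2 hne), by rw [habs, hcard]⟩
  · rw [not_not.1 (mt hfaithful.1 hγ), mul_zero]
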